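/- Let $g$ be a real symmetric $4\times 4$ matrix with $\det g<0$ (a Lorentz inner product on $\mathbb R^4$). Let $SO^+(g)$ be the set of proper orthochronous Lorentz transformations, i.e. the connected component of the identity in the group $\{\Lambda\in\mathbb R^{4\times 4} : \Lambda^T g\Lambda=g,\ \det\Lambda=1\}$. For a $4\times4$ matrix $M$ let $\mathrm{tr}_2M$ denote the coefficient of $t^2$ in $\det(I+tM)$. A matrix of the form $uv^Tg-vu^Tg$ with $u,v\in\mathbb R^4$ is called a simple Lorentz bivector, and $\Lambda$ is called simple if $\Lambda=\exp(L)$ for some simple Lorentz bivector $L$. Then for every $\Lambda\in SO^+(g)$: $\Lambda$ is simple if and only if $\mathrm{tr}_2\Lambda=2\,\mathrm{tr}\,\Lambda-2$ and $\mathrm{tr}\,\Lambda\geq 0$. -/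

import Mathlib

namespace LorentzDecomp

/-- Real `4 × 4` matrices, i.e. linear transformations of `ℝ⁴`, with the entrywise topology. -/
abbrev Mat4 : Type := Matrix (Fin 4) (Fin 4) ℝ

/-- The `k`-th order trace of `M`: the coefficient of `t ^ k` in `det (I + t M)`. -/
noncomputable def trk (k : ℕ) (M : Mat4) : ℝ :=
  (Matrix.det (1 + (Polynomial.X : Polynomial ℝ) • M.map Polynomial.C)).coeff k

/-- A Lorentz inner product on `ℝ⁴`, given by its Gram matrix: symmetric with negative determinant
(in particular nondegenerate); both signature conventions are allowed. -/
structure IsLorentzMetric (g : Mat4) : Prop where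
  symm : g.IsSymm
  det_neg : g.det < 0

/-- The simple Lorentz bivector `u ∧^g v = u vᵀ g - v uᵀ g`. -/
def wedge (g : Mat4) (u v : Fin 4 → ℝ) : Mat4 :=
  Matrix.vecMulVec u v * g - Matrix.vecMulVec v u * g

/-- The group of proper Lorentz transformations, as a set of matrices. -/
def properLorentz (g : Mat4) : Set Mat4 :=
  {A | A.transpose * g * A = g ∧ A.det = 1}

/-- `SO⁺(g)`: the connected component of the identity in the group of proper Lorentz
transformations. -/
def properOrthochronous (g : Mat4) : Set Mat4 :=
  connectedComponentIn (properLorentz g) 1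

/-- A transformation is simple if it is the exponential of a simple Lorentz bivector. -/
def IsSimple (g A : Mat4) : Prop :=
  ∃ u v : Fin 4 → ℝ, A = NormedSpace.exp (wedge g u v)

end LorentzDecomp

namespace LorentzDecomp
open Matrix

/-! For a simple bivector `L ^ 3 = δ L`, so `exp L = 1 + s L + c L ^ 2`, with coefficients
trigonometric, polynomial or hyperbolic according to the sign of `δ`. Its trace is `2 + 2x` with `x`
a `cos` or `cosh`, and the relation on `trk 2` follows. Conversely, let `τ = tr A`. As `A⁻¹` is
similar to `Aᵀ`, the characteristic polynomial is palindromic, and the relation makes it `(X - 1)²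
(X² - (τ - 2) X + 1)`. Put `B = A - A⁻¹`. It is `g`-skew and singular, hence a simple bivector, and
Cayley–Hamilton gives `B² = τ (A + A⁻¹ - 2)`. If `τ > 0`, then `A = 1 + B/2 + B²/(2τ)`, which is the
exponential of a multiple of `B`. If `τ = 0`, then `B² = 0`; the Lorentz signature forces `B = 0`,
so `A` is an involution of trace zero. Orthochronicity makes its `-1` eigenspace a spacelike plane,
and `A` is the rotation by `π` in it. -/

/-- The second coefficient of the characteristic polynomial in terms of traces. -/
lemma charpoly_coeff_two (M : Mat4) :
    M.charpoly.coeff 2 = (M.trace ^ 2 - (M * M).trace) / 2 := by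
  have key : M.charpoly =
      Polynomial.X ^ 4 - Polynomial.C M.trace * Polynomial.X ^ 3
        + Polynomial.C (M 0 0 * M 1 1 - M 0 1 * M 1 0 + M 0 0 * M 2 2 - M 0 2 * M 2 0
          + M 0 0 * M 3 3 - M 0 3 * M 3 0 + M 1 1 * M 2 2 - M 1 2 * M 2 1
          + M 1 1 * M 3 3 - M 1 3 * M 3 1 + M 2 2 * M 3 3 - M 2 3 * M 3 2) * Polynomial.X ^ 2
        - Polynomial.C M.adjugate.trace * Polynomial.X
        + Polynomial.C M.det := by
    rw [Matrix.charpoly]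
    simp only [adjugate_fin_succ_eq_det_submatrix, trace, diag, det_succ_row_zero,
      Fin.sum_univ_succ, charmatrix_apply, submatrix_apply]
    simp [Fin.succAbove, Fin.ext_iff, diagonal, Fin.succ, Fin.castSucc, Fin.castAdd,
      Fin.castLE, Fin.lt_def]
    ring
  rw [key]
  simp only [Polynomial.coeff_add, Polynomial.coeff_sub, Polynomial.coeff_C_mul,
    Polynomial.coeff_X_pow, Polynomial.coeff_X, Polynomial.coeff_C]
  simp [trace, mul_apply, Fin.sum_univ_succ]
  ring

/-- The second order trace in terms of ordinary traces. -/
lemma trk_two (M : Mat4) : trk 2 M = (M.trace ^ 2 - (M * M).trace) / 2 := by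
  have h : trk 2 M = (-M).charpolyRev.coeff 2 := by
    rw [trk, charpolyRev, Matrix.map_neg _ (fun _ ↦ Polynomial.C_neg), smul_neg, sub_neg_eq_add]
  rw [h, ← reverse_charpoly, Polynomial.coeff_reverse, charpoly_natDegree_eq_dim]
  have : Polynomial.revAt (Fintype.card (Fin 4)) 2 = 2 := by
    rw [Polynomial.revAt_le (by simp)]; simp
  rw [this, charpoly_coeff_two]
  simp

lemma charpoly_coeff_four (M : Mat4) : M.charpoly.coeff 4 = 1 := by
  have := M.charpoly_monic.coeff_natDegree
  rwa [charpoly_natDegree_eq_dim] at this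

/-- The Cayley–Hamilton theorem for `4 × 4` matrices. -/
lemma charpoly_aeval (M : Mat4) :
    M ^ 4 - M.trace • M ^ 3 + M.charpoly.coeff 2 • M ^ 2 + M.charpoly.coeff 1 • M +
      M.det • 1 = 0 := by
  have h := aeval_self_charpoly M
  have h3 := trace_eq_neg_charpoly_coeff M
  have h4 := charpoly_coeff_four M
  have h0 := det_eq_sign_charpoly_coeff M
  rw [Polynomial.aeval_eq_sum_range, charpoly_natDegree_eq_dim] at h
  simp [Finset.sum_range_succ, h4] at h h0 h3
  rw [h0, h3, ← h]
  module

/-! ### Algebra of simple bivectors -/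

lemma dotProduct_mulVec_comm {g : Mat4} (hg : g.IsSymm) (x y : Fin 4 → ℝ) :
    x ⬝ᵥ g *ᵥ y = y ⬝ᵥ g *ᵥ x := by
  rw [dotProduct_mulVec, dotProduct_comm, ← mulVec_transpose, hg.eq]

lemma vecMulVec_mul_mul_vecMulVec (g : Mat4) (a b c d : Fin 4 → ℝ) :
    vecMulVec a b * g * (vecMulVec c d * g) = (b ⬝ᵥ g *ᵥ c) • (vecMulVec a d * g) := by
  rw [← Matrix.mul_assoc, Matrix.mul_assoc (vecMulVec a b), mul_vecMulVec, vecMulVec_mul_vecMulVec]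
  simp

lemma trace_vecMulVec_mul {g : Mat4} (hg : g.IsSymm) (a b : Fin 4 → ℝ) :
    (vecMulVec a b * g).trace = a ⬝ᵥ g *ᵥ b := by
  rw [Matrix.trace_mul_comm, mul_vecMulVec, trace_vecMulVec, dotProduct_comm,
    dotProduct_mulVec_comm hg]

lemma wedge_mul_self {g : Mat4} (hg : g.IsSymm) (u v : Fin 4 → ℝ) :
    wedge g u v * wedge g u v =
      (u ⬝ᵥ g *ᵥ v) • (vecMulVec u v * g + vecMulVec v u * g)
      - (v ⬝ᵥ g *ᵥ v) • (vecMulVec u u * g) - (u ⬝ᵥ g *ᵥ u) • (vecMulVec v v * g) := by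
  simp only [wedge, sub_mul, mul_sub, vecMulVec_mul_mul_vecMulVec, dotProduct_mulVec_comm hg v u]
  module

/-- The invariant `δ` with `L ^ 3 = δ L` for `L = u ∧ v`. -/
def disc (g : Mat4) (u v : Fin 4 → ℝ) : ℝ :=
  (u ⬝ᵥ g *ᵥ v) ^ 2 - (u ⬝ᵥ g *ᵥ u) * (v ⬝ᵥ g *ᵥ v)

lemma wedge_cube {g : Mat4} (hg : g.IsSymm) (u v : Fin 4 → ℝ) :
    wedge g u v * (wedge g u v * wedge g u v) = disc g u v • wedge g u v := by
  rw [wedge_mul_self hg]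
  simp only [wedge, sub_mul, mul_sub, mul_add, Matrix.mul_smul, vecMulVec_mul_mul_vecMulVec,
    dotProduct_mulVec_comm hg v u, disc]
  module

lemma trace_wedge {g : Mat4} (hg : g.IsSymm) (u v : Fin 4 → ℝ) : (wedge g u v).trace = 0 := by
  simp [wedge, trace_vecMulVec_mul hg, dotProduct_mulVec_comm hg v u]

lemma trace_wedge_mul_self {g : Mat4} (hg : g.IsSymm) (u v : Fin 4 → ℝ) :
    (wedge g u v * wedge g u v).trace = 2 * disc g u v := by
  simp only [wedge_mul_self hg, trace_sub, trace_smul, trace_add, trace_vecMulVec_mul hg,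
    dotProduct_mulVec_comm hg v u, disc, smul_eq_mul]
  ring

lemma smul_wedge (g : Mat4) (r : ℝ) (u v : Fin 4 → ℝ) : r • wedge g u v = wedge g (r • u) v := by
  simp [wedge, smul_sub]

/-! ### Closed forms of the exponential -/

/-- The exponential of an element with `L ^ 3 = δ L` is characterised by a differential equation. -/
lemma exp_eq_of_hasDerivAt {𝔸 : Type*} [NormedRing 𝔸] [NormedAlgebra ℝ 𝔸] [CompleteSpace 𝔸]
    (L : 𝔸) {S C : ℝ → ℝ} {δ : ℝ} (hL : L * (L * L) = δ • L)
    (hS : ∀ t, HasDerivAt S (1 + δ * C t) t) (hC : ∀ t, HasDerivAt C (S t) t)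
    (hS0 : S 0 = 0) (hC0 : C 0 = 0) :
    NormedSpace.exp L = 1 + S 1 • L + C 1 • (L * L) := by
  let _ : NormedAlgebra ℚ 𝔸 := NormedAlgebra.restrictScalars ℚ ℝ 𝔸
  -- Both factors solve linear equations with opposite generators, so the product is constant, equal
  -- to its value `1` at `t = 0`.
  have hd : ∀ t : ℝ, HasDerivAt (fun t : ℝ ↦ NormedSpace.exp (t • (-L)) *
      (1 + S t • L + C t • (L * L))) 0 t := by
    intro t
    have h1 := hasDerivAt_exp_smul_const (𝕂 := ℝ) (-L) t
    have h2 : HasDerivAt (fun t : ℝ ↦ 1 + S t • L + C t • (L * L))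
        ((1 + δ * C t) • L + S t • (L * L)) t :=
      (((hS t).smul_const L).const_add 1).add ((hC t).smul_const (L * L))
    refine (h1.mul h2).congr_deriv ?_
    rw [mul_assoc, ← mul_add]
    have : -L * (1 + S t • L + C t • (L * L)) + ((1 + δ * C t) • L + S t • (L * L)) = 0 := by
      simp only [neg_mul, mul_add, mul_one, mul_smul_comm, hL]
      module
    rw [this, mul_zero]
  have hc := is_const_of_deriv_eq_zero (fun t ↦ (hd t).differentiableAt) (fun t ↦ (hd t).deriv) 1 0
  simp only [one_smul, zero_smul, hS0, hC0, add_zero, NormedSpace.exp_zero, mul_one] at hc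
  have h := congrArg (fun X ↦ NormedSpace.exp L * X) hc
  simp only [← mul_assoc] at h
  rw [← NormedSpace.exp_add_of_commute ((Commute.refl L).neg_right)] at h
  simpa [mul_assoc] using h.symm

attribute [local instance] Matrix.linftyOpNormedRing Matrix.linftyOpNormedAlgebra in
lemma matrix_exp_eq_of_hasDerivAt {L : Mat4} {S C : ℝ → ℝ} {δ : ℝ} (hL : L * (L * L) = δ • L)
    (hS : ∀ t, HasDerivAt S (1 + δ * C t) t) (hC : ∀ t, HasDerivAt C (S t) t)
    (hS0 : S 0 = 0) (hC0 : C 0 = 0) :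
    NormedSpace.exp L = 1 + S 1 • L + C 1 • (L * L) :=
  exp_eq_of_hasDerivAt L hL hS hC hS0 hC0

lemma exp_of_cube_pos {L : Mat4} {w : ℝ} (hw : w ≠ 0) (hL : L * (L * L) = (w ^ 2) • L) :
    NormedSpace.exp L =
      1 + (Real.sinh w / w) • L + ((Real.cosh w - 1) / w ^ 2) • (L * L) := by
  have hm (t : ℝ) : HasDerivAt (fun t : ℝ ↦ w * t) w t := by
    simpa using (hasDerivAt_id t).const_mul w
  have h := matrix_exp_eq_of_hasDerivAt (L := L) (S := fun t ↦ Real.sinh (w * t) / w)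
    (C := fun t ↦ (Real.cosh (w * t) - 1) / w ^ 2) hL
    (fun t ↦ by
      refine ((hm t).sinh.div_const w).congr_deriv ?_
      field_simp
      ring)
    (fun t ↦ by
      refine (((hm t).cosh.sub_const 1).div_const (w ^ 2)).congr_deriv ?_
      field_simp)
    (by simp) (by simp)
  simpa using h

lemma exp_of_cube_neg {L : Mat4} {w : ℝ} (hw : w ≠ 0) (hL : L * (L * L) = (-w ^ 2) • L) :
    NormedSpace.exp L =
      1 + (Real.sin w / w) • L + ((1 - Real.cos w) / w ^ 2) • (L * L) := by
  have hm (t : ℝ) : HasDerivAt (fun t : ℝ ↦ w * t) w t := by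
    simpa using (hasDerivAt_id t).const_mul w
  have h := matrix_exp_eq_of_hasDerivAt (L := L) (S := fun t ↦ Real.sin (w * t) / w)
    (C := fun t ↦ (1 - Real.cos (w * t)) / w ^ 2) hL
    (fun t ↦ by
      refine ((hm t).sin.div_const w).congr_deriv ?_
      field_simp
      ring)
    (fun t ↦ by
      refine (((hm t).cos.const_sub 1).div_const (w ^ 2)).congr_deriv ?_
      field_simp)
    (by simp) (by simp)
  simpa using h

lemma exp_of_cube_zero {L : Mat4} (hL : L * (L * L) = 0) :
    NormedSpace.exp L = 1 + L + (1 / 2 : ℝ) • (L * L) := by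
  have h := matrix_exp_eq_of_hasDerivAt (L := L) (S := fun t ↦ t) (C := fun t ↦ t ^ 2 / 2) (δ := 0)
    (by simpa using hL)
    (fun t ↦ (hasDerivAt_id' t).congr_deriv (by simp))
    (fun t ↦ by
      refine ((hasDerivAt_pow 2 t).div_const 2).congr_deriv ?_
      simp)
    (by simp) (by simp)
  simpa using h

/-- Traces of the exponential of a simple bivector and of its square, through one number `x`
standing for `cosh` or `cos`. -/
lemma exists_trace_exp_wedge {g : Mat4} (hg : g.IsSymm) (u v : Fin 4 → ℝ) :
    ∃ x : ℝ, -1 ≤ x ∧ (NormedSpace.exp (wedge g u v)).trace = 2 + 2 * x ∧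
      (NormedSpace.exp (wedge g u v) * NormedSpace.exp (wedge g u v)).trace
        = 2 + 2 * (2 * x ^ 2 - 1) := by
  have h3 := wedge_cube hg u v
  have h1 := trace_wedge hg u v
  have h2 := trace_wedge_mul_self hg u v
  set L := wedge g u v
  have sq (s c : ℝ) : ((1 + s • L + c • (L * L)) * (1 + s • L + c • (L * L))).trace =
      4 + (s ^ 2 + 2 * c + c ^ 2 * disc g u v) * (2 * disc g u v) := by
    have : (1 + s • L + c • (L * L)) * (1 + s • L + c • (L * L)) =
        1 + (2 * s + 2 * s * c * disc g u v) • L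
          + (s ^ 2 + 2 * c + c ^ 2 * disc g u v) • (L * L) := by
      simp only [mul_add, add_mul, Matrix.mul_smul, Matrix.smul_mul, mul_one, one_mul,
        Matrix.mul_assoc, h3]
      module
    rw [this]
    simp [h1, h2]
  have tr (s c : ℝ) : (1 + s • L + c • (L * L)).trace = 4 + c * (2 * disc g u v) := by
    simp [h1, h2]
  rcases lt_trichotomy (disc g u v) 0 with hd | hd | hd
  · obtain ⟨w, hw, hw'⟩ : ∃ w : ℝ, w ≠ 0 ∧ disc g u v = -w ^ 2 :=
      ⟨√(-disc g u v), (Real.sqrt_pos.2 (by linarith)).ne', by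
        rw [Real.sq_sqrt (by linarith)]; ring⟩
    rw [hw'] at h3
    rw [exp_of_cube_neg hw h3, sq, tr, hw']
    refine ⟨Real.cos w, Real.neg_one_le_cos w, ?_, ?_⟩
    · field_simp
      ring
    · field_simp
      rw [Real.sin_sq]
      ring
  · rw [hd, zero_smul] at h3
    have he := exp_of_cube_zero h3
    rw [show 1 + L = 1 + (1 : ℝ) • L by rw [one_smul]] at he
    rw [he, sq, tr, hd]
    exact ⟨1, by norm_num, by norm_num, by norm_num⟩
  · obtain ⟨w, hw, hw'⟩ : ∃ w : ℝ, w ≠ 0 ∧ disc g u v = w ^ 2 :=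
      ⟨√(disc g u v), (Real.sqrt_pos.2 hd).ne', by rw [Real.sq_sqrt hd.le]⟩
    rw [hw'] at h3
    rw [exp_of_cube_pos hw h3, sq, tr, hw']
    refine ⟨Real.cosh w, by linarith [Real.one_le_cosh w], ?_, ?_⟩
    · field_simp
      ring
    · field_simp
      rw [Real.sinh_sq]
      ring

lemma trk_of_isSimple {g : Mat4} (hg : g.IsSymm) {A : Mat4} (hA : IsSimple g A) :
    trk 2 A = 2 * A.trace - 2 ∧ 0 ≤ A.trace := by
  obtain ⟨u, v, rfl⟩ := hA
  obtain ⟨x, hx, h1, h2⟩ := exists_trace_exp_wedge hg u v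
  rw [trk_two, h1, h2]
  constructor
  · ring
  · linarith

/-! ### Singular skew matrices are simple -/

/-- A singular antisymmetric `4 × 4` matrix is a simple bivector. -/
lemma exists_eq_vecMulVec_sub {K : Mat4} (hK : Kᵀ = -K) (hdet : K.det = 0) :
    ∃ u v : Fin 4 → ℝ, K = vecMulVec u v - vecMulVec v u := by
  have anti (i j : Fin 4) : K j i = -K i j := congrFun₂ hK i j
  have diag (i : Fin 4) : K i i = 0 := by linarith [anti i i]
  -- The determinant is the square of this Pfaffian, whose vanishing is the Plücker relation.
  have pf : K 0 1 * K 2 3 - K 0 2 * K 1 3 + K 0 3 * K 1 2 = 0 := by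
    have : K.det = (K 0 1 * K 2 3 - K 0 2 * K 1 3 + K 0 3 * K 1 2) ^ 2 := by
      simp only [det_succ_row_zero, Fin.sum_univ_succ, submatrix_apply]
      simp [Fin.succAbove, Fin.ext_iff, Fin.succ, Fin.castSucc, Fin.castAdd, Fin.castLE]
      simp only [diag, anti 0 1, anti 0 2, anti 0 3, anti 1 2, anti 1 3, anti 2 3]
      ring
    rw [hdet] at this
    exact pow_eq_zero_iff two_ne_zero |>.1 this.symm
  have plucker (i j a b : Fin 4) : K a b * K i j = K a i * K b j - K b i * K a j := by
    fin_cases i <;> fin_cases j <;> fin_cases a <;> fin_cases b <;>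
      simp only [Fin.zero_eta, Fin.mk_one, Fin.reduceFinMk, diag, anti 0 1, anti 0 2, anti 0 3,
        anti 1 2, anti 1 3, anti 2 3] <;>
      first | ring1 | linear_combination pf | linear_combination (exp := 1) -pf
  by_cases h0 : K = 0
  · exact ⟨0, 0, by simp [h0]⟩
  obtain ⟨i, j, hij⟩ : ∃ i j, K i j ≠ 0 := by
    by_contra! h
    exact h0 (by ext i j; exact h i j)
  -- Columns `i` and `j` of `K`, normalised by the nonzero entry `K i j`.
  refine ⟨fun a ↦ K a i / K i j, fun b ↦ K b j, ?_⟩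
  ext a b
  have := plucker i j a b
  simp only [Matrix.sub_apply, vecMulVec_apply]
  field_simp
  linarith

variable {g A : Mat4}

/-! ### Converse for positive trace -/

lemma transpose_mul_eq_mul_inv (hA : A ∈ properLorentz g) : Aᵀ * g = g * A⁻¹ := by
  have hu : IsUnit A.det := by simp [hA.2]
  calc Aᵀ * g = Aᵀ * g * A * A⁻¹ := by rw [Matrix.mul_assoc _ A, mul_nonsing_inv A hu, mul_one]
    _ = g * A⁻¹ := by rw [hA.1]

lemma inv_eq_conj (hg : g.det ≠ 0) (hA : A ∈ properLorentz g) : A⁻¹ = g⁻¹ * Aᵀ * g := by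
  rw [Matrix.mul_assoc, transpose_mul_eq_mul_inv hA, ← Matrix.mul_assoc,
    nonsing_inv_mul g (by simpa using hg), one_mul]

lemma trace_inv_of_mem (hg : g.det ≠ 0) (hA : A ∈ properLorentz g) : A⁻¹.trace = A.trace := by
  rw [inv_eq_conj hg hA, trace_mul_comm, ← Matrix.mul_assoc,
    mul_nonsing_inv g (by simpa using hg), one_mul, trace_transpose]

/-- `A⁻¹` is similar to `Aᵀ`, so `A` and `A⁻¹` share a characteristic polynomial. -/
lemma charpoly_coeff_one_of_mem (hg : g.det ≠ 0) (hA : A ∈ properLorentz g) :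
    A.charpoly.coeff 1 = -A.trace := by
  have h1 : A⁻¹.charpoly = A.charpoly := by
    rw [inv_eq_conj hg hA, charpoly_mul_comm, ← Matrix.mul_assoc,
      mul_nonsing_inv g (by simpa using hg), one_mul, charpoly_transpose]
  rw [← h1, charpoly_inv A (by rw [isUnit_iff_isUnit_det, hA.2]; exact isUnit_one)]
  have h : (-1 : Polynomial ℝ) ^ 4 = 1 := by norm_num
  simp [hA.2, h, coeff_charpolyRev_eq_neg_trace]

lemma trk_two_eq_charpoly_coeff (M : Mat4) : trk 2 M = M.charpoly.coeff 2 := by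
  rw [trk_two, charpoly_coeff_two]

/-- The square of `A - A⁻¹` for a proper Lorentz transformation subject to the trace relation. -/
lemma sub_inv_mul_self (hg : g.det ≠ 0) (hA : A ∈ properLorentz g)
    (ht : trk 2 A = 2 * A.trace - 2) :
    (A - A⁻¹) * (A - A⁻¹) = A.trace • (A + A⁻¹ - (2 : ℝ) • 1) := by
  have hu : IsUnit A.det := by simp [hA.2]
  have h := charpoly_aeval A
  rw [← trk_two_eq_charpoly_coeff, ht, charpoly_coeff_one_of_mem hg hA, hA.2] at h
  -- Dividing Cayley–Hamilton by `A²` leaves an expression symmetric in `A` and `A⁻¹`.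
  have h' := congrArg (fun X ↦ A⁻¹ * (X * A⁻¹)) h
  have e1 : A⁻¹ * A = 1 := nonsing_inv_mul A hu
  have e2 : A * A⁻¹ = 1 := mul_nonsing_inv A hu
  have e3 (X : Mat4) : A⁻¹ * (A * X) = X := by rw [← Matrix.mul_assoc, e1, one_mul]
  simp only [pow_succ, pow_zero, one_mul, add_mul, sub_mul, mul_add, mul_sub, Matrix.smul_mul,
    Matrix.mul_smul, Matrix.mul_assoc, e1, e2, e3, mul_one, zero_mul, mul_zero] at h'
  simp only [sub_mul, mul_sub, e1, e2]
  rw [← sub_eq_zero, ← h']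
  module

lemma det_sub_inv (hg : g.det ≠ 0) (hA : A ∈ properLorentz g)
    (ht : trk 2 A = 2 * A.trace - 2) : (A - A⁻¹).det = 0 := by
  have hu : IsUnit A.det := by simp [hA.2]
  -- The trace relation says exactly that `1` is a root of the palindromic characteristic
  -- polynomial.
  have h1 : (1 - A).det = 0 := by
    have h := eval_charpoly A 1
    have h4 := charpoly_coeff_four A
    have h3 := trace_eq_neg_charpoly_coeff A
    have h0 := det_eq_sign_charpoly_coeff A
    rw [Polynomial.eval_eq_sum_range, charpoly_natDegree_eq_dim] at h
    simp [Finset.sum_range_succ, h4, ← trk_two_eq_charpoly_coeff, ht,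
      charpoly_coeff_one_of_mem hg hA, hA.2] at h h0 h3
    rw [← h]
    linarith
  have : A - A⁻¹ = -((1 - A) * (A⁻¹ * (1 + A))) := by
    have e1 : A⁻¹ * A = 1 := nonsing_inv_mul A hu
    have e2 : A * A⁻¹ = 1 := mul_nonsing_inv A hu
    simp only [mul_add, sub_mul, mul_one, one_mul, e1, e2]
    abel
  rw [this, det_neg, det_mul, h1]
  simp

lemma exists_sub_inv_eq_wedge (hg : g.det ≠ 0) (hs : g.IsSymm) (hA : A ∈ properLorentz g)
    (ht : trk 2 A = 2 * A.trace - 2) : ∃ u v, A - A⁻¹ = wedge g u v := by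
  have hu : IsUnit g.det := by simpa using hg
  have key : (A * g⁻¹)ᵀ = A⁻¹ * g⁻¹ := by
    rw [inv_eq_conj hg hA, Matrix.mul_assoc, mul_nonsing_inv g hu, mul_one, transpose_mul,
      transpose_nonsing_inv, hs.eq]
  have key' : (A⁻¹ * g⁻¹)ᵀ = A * g⁻¹ := by rw [← key, transpose_transpose]
  obtain ⟨u, v, h⟩ := exists_eq_vecMulVec_sub (K := (A - A⁻¹) * g⁻¹)
    (by rw [sub_mul, transpose_sub, key, key']; abel)
    (by rw [det_mul, det_sub_inv hg hA ht, zero_mul])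
  refine ⟨u, v, ?_⟩
  rw [wedge, ← sub_mul, ← h, Matrix.mul_assoc, nonsing_inv_mul g hu, mul_one]

lemma isSimple_of_exp_smul {u v : Fin 4 → ℝ} {r : ℝ}
    (h : A = NormedSpace.exp (r • wedge g u v)) : IsSimple g A :=
  ⟨r • u, v, by rw [h, smul_wedge]⟩

/-- The converse direction when the trace is positive. -/
lemma isSimple_of_trace_pos (hg : g.det ≠ 0) (hs : g.IsSymm) (hA : A ∈ properLorentz g)
    (ht : trk 2 A = 2 * A.trace - 2) (hpos : 0 < A.trace) : IsSimple g A := by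
  have h2 := sub_inv_mul_self hg hA ht
  obtain ⟨u, v, hB⟩ := exists_sub_inv_eq_wedge hg hs hA ht
  have hd : disc g u v = A.trace * (A.trace - 4) := by
    have h := congrArg trace h2
    rw [hB, trace_wedge_mul_self hs] at h
    simp [trace_inv_of_mem hg hA] at h
    linarith
  have h3 := wedge_cube hs u v
  have hA' : A = 1 + (1 / 2 : ℝ) • wedge g u v
      + (1 / (2 * A.trace)) • (wedge g u v * wedge g u v) := by
    rw [← hB, h2, smul_smul, show 1 / (2 * A.trace) * A.trace = 1 / 2 by field_simp]
    module
  set B := wedge g u v with hBdef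
  rw [hd] at h3
  set τ := A.trace with hτ
  have cube (r : ℝ) : (r • B) * ((r • B) * (r • B)) = (r ^ 2 * (τ * (τ - 4))) • (r • B) := by
    simp only [Matrix.mul_smul, Matrix.smul_mul, h3]
    module
  rcases lt_trichotomy τ 4 with h4 | h4 | h4
  -- The angle is read off from `τ = 2 + 2 cos w`; `0 < τ < 4` keeps `sin w` nonzero, and the scale
  -- `r` makes the linear term `B/2`.
  · set w := Real.arccos (τ / 2 - 1) with hw
    have hc : Real.cos w = τ / 2 - 1 := Real.cos_arccos (by linarith) (by linarith)
    have hs0 : 0 < Real.sin w := by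
      rw [hw, Real.sin_arccos]
      exact Real.sqrt_pos.2 (by nlinarith)
    have hw0 : w ≠ 0 := by
      intro h
      simp [h] at hs0
    have hsq := Real.sin_sq w
    rw [hc] at hsq
    refine isSimple_of_exp_smul (u := u) (v := v) (r := w / (2 * Real.sin w)) ?_
    rw [← hBdef, exp_of_cube_neg hw0, hc]
    · rw [hA']
      simp only [Matrix.mul_smul, Matrix.smul_mul, smul_smul]
      congr 2
      · congr 2
        field_simp
      · field_simp
        rw [hsq]
        ring
    · rw [cube]
      congr 1
      field_simp
      rw [hsq]
      ring
  · refine isSimple_of_exp_smul (u := u) (v := v) (r := 1 / 2) ?_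
    rw [← hBdef, exp_of_cube_zero]
    · rw [hA', h4]
      simp only [Matrix.mul_smul, Matrix.smul_mul, smul_smul]
      norm_num
    · rw [cube, h4]
      simp
  · set w := Real.arcosh (τ / 2 - 1) with hw
    have hc : Real.cosh w = τ / 2 - 1 := Real.cosh_arcosh (by linarith)
    have hsq := Real.sinh_sq w
    rw [hc] at hsq
    have hs0 : Real.sinh w ≠ 0 := by
      intro h
      rw [h] at hsq
      nlinarith
    have hw0 : w ≠ 0 := by
      intro h
      simp [h] at hs0
    refine isSimple_of_exp_smul (u := u) (v := v) (r := w / (2 * Real.sinh w)) ?_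
    rw [← hBdef, exp_of_cube_pos hw0, hc]
    · rw [hA']
      simp only [Matrix.mul_smul, Matrix.smul_mul, smul_smul]
      congr 2
      · congr 2
        field_simp
      · field_simp
        rw [hsq]
        ring
    · rw [cube]
      congr 1
      field_simp
      rw [hsq]
      ring

/-! ### Signature and time orientation -/

/-- `e` is timelike with respect to the symmetric form `g` of signature `(3, 1)`: it has negative
square and `g` is positive definite on its orthogonal complement. -/
structure IsTimelike (g : Mat4) (e : Fin 4 → ℝ) : Prop where
  neg : e ⬝ᵥ g *ᵥ e < 0
  pos_of_orthogonal : ∀ x, x ≠ 0 → e ⬝ᵥ g *ᵥ x = 0 → 0 < x ⬝ᵥ g *ᵥ x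

lemma exists_sign_of_prod_neg {l : Fin 4 → ℝ} (h : ∏ i, l i < 0) :
    ∃ j, (l j < 0 ∧ ∀ i, i ≠ j → 0 < l i) ∨ (0 < l j ∧ ∀ i, i ≠ j → l i < 0) := by
  rw [Fin.prod_univ_four, mul_assoc, mul_neg_iff] at h
  simp only [mul_pos_iff, mul_neg_iff] at h
  simp only [Fin.exists_fin_succ, Fin.forall_fin_succ]
  rcases h with ⟨⟨h0, h1⟩ | ⟨h0, h1⟩, ⟨h2, h3⟩ | ⟨h2, h3⟩⟩ |
      ⟨⟨h0, h1⟩ | ⟨h0, h1⟩, ⟨h2, h3⟩ | ⟨h2, h3⟩⟩ <;>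
    simp [h0, h1, h2, h3, Fin.ext_iff]

lemma isTimelike_of_eq_diagonal {g P : Mat4} {l : Fin 4 → ℝ} (hP : Pᵀ * P = 1)
    (hg : g = P * diagonal l * Pᵀ) {j : Fin 4} (hj : l j < 0) (hl : ∀ i, i ≠ j → 0 < l i) :
    IsTimelike g (P *ᵥ Pi.single j 1) := by
  have hb (x y : Fin 4 → ℝ) : x ⬝ᵥ g *ᵥ y = ∑ i, l i * (Pᵀ *ᵥ x) i * (Pᵀ *ᵥ y) i := by
    rw [hg, ← mulVec_mulVec, ← mulVec_mulVec, dotProduct_mulVec, ← mulVec_transpose]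
    simp [dotProduct, mulVec_diagonal]
    exact Finset.sum_congr rfl fun i _ ↦ by ring
  have he : Pᵀ *ᵥ (P *ᵥ Pi.single j 1) = Pi.single j 1 := by rw [mulVec_mulVec, hP, one_mulVec]
  constructor
  · rw [hb, he]
    simpa [Pi.single_apply] using hj
  · intro x hx h
    rw [hb, he] at h
    have hxj : (Pᵀ *ᵥ x) j = 0 := by simpa [Pi.single_apply, hj.ne] using h
    have hx' : Pᵀ *ᵥ x ≠ 0 := by
      intro h0
      apply hx
      have : P *ᵥ (Pᵀ *ᵥ x) = x := by rw [mulVec_mulVec, mul_eq_one_comm.1 hP, one_mulVec]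
      rw [← this, h0, mulVec_zero]
    obtain ⟨k, hk⟩ := Function.ne_iff.1 hx'
    have hkj : k ≠ j := by
      rintro rfl
      exact hk hxj
    rw [hb]
    refine Finset.sum_pos' (fun i _ ↦ ?_) ⟨k, Finset.mem_univ k, ?_⟩
    · rw [mul_assoc]
      by_cases hi : i = j
      · simp [hi, hxj]
      · exact mul_nonneg (hl i hi).le (mul_self_nonneg _)
    · rw [mul_assoc]
      exact mul_pos (hl k hkj) (mul_self_pos.2 hk)

/-- A negative determinant means one or three negative eigenvalues; the odd one out gives the
timelike eigenvector, up to the sign of `g`. -/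
lemma exists_isTimelike {g : Mat4} (hg : IsLorentzMetric g) :
    (∃ e, IsTimelike g e) ∨ ∃ e, IsTimelike (-g) e := by
  have hH : g.IsHermitian := by
    rw [IsHermitian, conjTranspose_eq_transpose_of_trivial, hg.symm.eq]
  have hdet := hH.det_eq_prod_eigenvalues
  obtain ⟨j, hj⟩ := exists_sign_of_prod_neg (l := hH.eigenvalues) (by
    have := hg.det_neg
    rw [hdet] at this
    simpa using this)
  let P : Mat4 := hH.eigenvectorUnitary.1
  have hP : Pᵀ * P = 1 := by
    have := Unitary.coe_star_mul_self hH.eigenvectorUnitary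
    rwa [star_eq_conjTranspose, conjTranspose_eq_transpose_of_trivial] at this
  have hgP : g = P * diagonal hH.eigenvalues * Pᵀ := by
    have := hH.spectral_theorem
    rw [Unitary.conjStarAlgAut_apply, star_eq_conjTranspose,
      conjTranspose_eq_transpose_of_trivial] at this
    exact this
  rcases hj with ⟨h1, h2⟩ | ⟨h1, h2⟩
  · exact Or.inl ⟨_, isTimelike_of_eq_diagonal hP hgP h1 h2⟩
  · refine Or.inr ⟨_, isTimelike_of_eq_diagonal (l := -hH.eigenvalues) (j := j) hP ?_
      (by simpa using h1) (by simpa using h2)⟩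
    have hd : diagonal (-hH.eigenvalues) = -diagonal hH.eigenvalues := (diagonal_neg _).symm
    rw [hd, mul_neg, neg_mul, ← hgP]

variable {e : Fin 4 → ℝ}

/-- The orthogonal complement of any vector of negative square is positive definite. -/
lemma IsTimelike.of_neg (hs : g.IsSymm) (he : IsTimelike g e) {t : Fin 4 → ℝ}
    (ht : t ⬝ᵥ g *ᵥ t < 0) : IsTimelike g t := by
  refine ⟨ht, fun x hx htx ↦ ?_⟩
  have het : e ⬝ᵥ g *ᵥ t ≠ 0 := by
    intro h
    have ht0 : t ≠ 0 := by
      rintro rfl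
      simp at ht
    linarith [he.pos_of_orthogonal t ht0 h]
  set a := e ⬝ᵥ g *ᵥ t with ha
  set c := e ⬝ᵥ g *ᵥ x with hc
  by_cases hc0 : c = 0
  · exact he.pos_of_orthogonal x hx hc0
  have hxt : x ⬝ᵥ g *ᵥ t = 0 := by rw [dotProduct_mulVec_comm hs, htx]
  -- This combination is orthogonal to `e`, hence has positive square `a² (x·x) + c² (t·t)`.
  have hy : a • x - c • t ≠ 0 := by
    intro h
    have h1 := congrArg (fun y ↦ t ⬝ᵥ g *ᵥ y) h
    simp [mulVec_sub, mulVec_smul, htx, hc0] at h1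
    exact ht.ne h1
  have h1 := he.pos_of_orthogonal _ hy (by
    simp only [mulVec_sub, mulVec_smul, dotProduct_sub, dotProduct_smul, ← ha, ← hc, smul_eq_mul]
    ring)
  simp only [mulVec_sub, mulVec_smul, dotProduct_sub, dotProduct_smul, sub_dotProduct,
    smul_dotProduct, htx, hxt, smul_eq_mul] at h1
  have ha2 : 0 < a ^ 2 := by positivity
  have hc2 : 0 ≤ c ^ 2 := by positivity
  by_contra! hn
  nlinarith [mul_nonneg hc2 (neg_nonneg.2 ht.le), mul_nonneg ha2.le (neg_nonneg.2 hn)]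

lemma dotProduct_mulVec_mulVec (hA : Aᵀ * g * A = g) (x y : Fin 4 → ℝ) :
    (A *ᵥ x) ⬝ᵥ g *ᵥ (A *ᵥ y) = x ⬝ᵥ g *ᵥ y := by
  conv_rhs => rw [← hA, ← mulVec_mulVec, ← mulVec_mulVec, dotProduct_mulVec, vecMul_transpose]

/-- Proper orthochronous transformations preserve the time orientation. -/
lemma timelike_orientation (he : IsTimelike g e)
    (hA : A ∈ properOrthochronous g) : e ⬝ᵥ g *ᵥ (A *ᵥ e) < 0 := by
  -- If `M e` were orthogonal to `e`, its square would be positive, yet `M` preserves the negative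
  -- square of `e`.
  have hne : ∀ M ∈ properOrthochronous g, e ⬝ᵥ g *ᵥ (M *ᵥ e) ≠ 0 := by
    intro M hM h
    have hM' := connectedComponentIn_subset _ _ hM
    have h2 := dotProduct_mulVec_mulVec hM'.1 e e
    have h0 : M *ᵥ e ≠ 0 := by
      intro h0
      rw [h0] at h2
      simp at h2
      exact he.neg.ne h2.symm
    linarith [he.pos_of_orthogonal _ h0 h, he.neg]
  have hcont : Continuous fun M : Mat4 ↦ e ⬝ᵥ g *ᵥ (M *ᵥ e) := by fun_prop
  have h1 : (1 : Mat4) ∈ properOrthochronous g :=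
    mem_connectedComponentIn (by simp [properLorentz])
  by_contra! h
  obtain ⟨M, hM, hM0⟩ := isPreconnected_connectedComponentIn.intermediate_value h1 hA
    hcont.continuousOn (show (0 : ℝ) ∈ Set.Icc _ _ from ⟨by simpa using he.neg.le, h⟩)
  exact hne M hM hM0

/-! ### Converse for trace zero -/

/-- A skew endomorphism of Lorentz space with square zero vanishes. -/
lemma eq_zero_of_skew_of_mul_self_eq_zero (hs : g.IsSymm) (he : IsTimelike g e)
    {B : Mat4} (hB : Bᵀ * g = -(g * B)) (h2 : B * B = 0) : B = 0 := by
  have skew (x y : Fin 4 → ℝ) : (B *ᵥ x) ⬝ᵥ g *ᵥ y = -(x ⬝ᵥ g *ᵥ (B *ᵥ y)) := by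
    have : (B *ᵥ x) ⬝ᵥ g *ᵥ y = x ⬝ᵥ (Bᵀ * g) *ᵥ y := by
      rw [← mulVec_mulVec, dotProduct_mulVec x, vecMul_transpose]
    rw [this, hB, neg_mulVec, dotProduct_neg, mulVec_mulVec]
  -- `B x` is isotropic, since its square is `-(x · B² x) = 0`; no nonzero isotropic vector is
  -- orthogonal to `e`.
  have key (x : Fin 4 → ℝ) (hx : e ⬝ᵥ g *ᵥ (B *ᵥ x) = 0) : B *ᵥ x = 0 := by
    by_contra h0
    have h := he.pos_of_orthogonal _ h0 hx
    rw [skew, mulVec_mulVec _ B, h2] at h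
    simp at h
  have hBe : B *ᵥ e = 0 := by
    apply key
    have h := skew e e
    rw [dotProduct_mulVec_comm hs] at h
    linarith
  refine ext_of_mulVec_single fun i ↦ ?_
  rw [zero_mulVec]
  apply key
  have h := skew e (Pi.single i 1)
  rw [hBe, zero_dotProduct] at h
  linarith

/-- Splitting a unit vector off an orthogonal projection onto a positive definite subspace. -/
lemma exists_unit_split (hs : g.IsSymm) {P : Mat4} (hP : P * P = P) (hPg : Pᵀ * g = g * P)
    (hpos : ∀ x, x ≠ 0 → P *ᵥ x = x → 0 < x ⬝ᵥ g *ᵥ x) (h0 : P ≠ 0) :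
    ∃ u Q, P = vecMulVec u u * g + Q ∧ u ⬝ᵥ g *ᵥ u = 1 ∧ Q * Q = Q ∧ Qᵀ * g = g * Q ∧
      ∀ x, Q *ᵥ x = x → P *ᵥ x = x ∧ u ⬝ᵥ g *ᵥ x = 0 := by
  obtain ⟨y, hy⟩ : ∃ y, P *ᵥ y ≠ 0 := by
    by_contra! h
    exact h0 (ext_of_mulVec_single fun i ↦ by rw [h, zero_mulVec])
  have hPy : P *ᵥ (P *ᵥ y) = P *ᵥ y := by rw [mulVec_mulVec, hP]
  have hq := hpos _ hy hPy
  set q := (P *ᵥ y) ⬝ᵥ g *ᵥ (P *ᵥ y) with hqdef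
  obtain ⟨u, hPu, hu⟩ : ∃ u, P *ᵥ u = u ∧ u ⬝ᵥ g *ᵥ u = 1 := by
    refine ⟨(√q)⁻¹ • (P *ᵥ y), by rw [mulVec_smul, hPy], ?_⟩
    simp only [mulVec_smul, dotProduct_smul, smul_dotProduct, ← hqdef, smul_eq_mul]
    rw [← mul_assoc, ← mul_inv, Real.mul_self_sqrt hq.le, inv_mul_cancel₀ hq.ne']
  set R := vecMulVec u u * g with hR
  have hRR : R * R = R := by rw [hR, vecMulVec_mul_mul_vecMulVec, hu, one_smul]
  have hPR : P * R = R := by rw [hR, ← Matrix.mul_assoc, mul_vecMulVec, hPu]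
  have hRg : Rᵀ * g = g * R := by
    rw [hR, transpose_mul, transpose_vecMulVec, hs.eq, Matrix.mul_assoc]
  have hRP : R * P = R := by
    rw [hR, Matrix.mul_assoc, ← hPg, ← Matrix.mul_assoc, vecMulVec_mul, vecMul_transpose, hPu]
  refine ⟨u, P - R, by abel, hu, ?_, ?_, fun x hx ↦ ?_⟩
  · simp only [sub_mul, mul_sub, hP, hPR, hRP, hRR]
    abel
  · simp only [transpose_sub, sub_mul, mul_sub, hPg, hRg]
  · have h1 : P *ᵥ x = x := by
      conv_lhs => rw [← hx]
      rw [mulVec_mulVec, mul_sub, hP, hPR, hx]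
    refine ⟨h1, ?_⟩
    rw [sub_mulVec, h1, sub_eq_self, hR, ← mulVec_mulVec, vecMulVec_mulVec] at hx
    have h2 := congrArg (fun y ↦ u ⬝ᵥ g *ᵥ y) hx
    simpa [mulVec_smul, hu] using h2

lemma eq_zero_of_mul_self_of_trace_eq_zero {P : Mat4} (hP : P * P = P) (ht : P.trace = 0) :
    P = 0 := by
  have h : IsIdempotentElem (toLin' P) := by
    rw [IsIdempotentElem, Module.End.mul_eq_comp, ← toLin'_mul, hP]
  have := LinearMap.IsIdempotentElem.eq_zero_of_trace_eq_zero h (by rw [trace_toLin'_eq, ht])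
  simpa using this

/-- A symmetric involution which is a half-turn in a spacelike plane is simple. -/
lemma isSimple_of_mul_self_eq_one (hs : g.IsSymm) (hAA : A * A = 1) (hAg : Aᵀ * g = g * A)
    (htr : A.trace = 0) (hpos : ∀ x, x ≠ 0 → A *ᵥ x = -x → 0 < x ⬝ᵥ g *ᵥ x) :
    IsSimple g A := by
  -- The orthogonal projection onto the `-1` eigenspace; its trace `2` allows splitting off exactly
  -- two unit vectors.
  obtain ⟨P, hP⟩ : ∃ P : Mat4, P = (1 / 2 : ℝ) • (1 - A) := ⟨_, rfl⟩
  have hA : A = 1 - (2 : ℝ) • P := by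
    rw [hP]
    module
  have hPP : P * P = P := by
    rw [hP]
    simp only [Matrix.smul_mul, Matrix.mul_smul, sub_mul, mul_sub, hAA, one_mul, mul_one]
    module
  have hPg : Pᵀ * g = g * P := by
    rw [hP]
    simp [sub_mul, mul_sub, hAg]
  have hPtr : P.trace = 2 := by
    rw [hP]
    simp [htr]
    norm_num
  have hPpos : ∀ x, x ≠ 0 → P *ᵥ x = x → 0 < x ⬝ᵥ g *ᵥ x := by
    intro x hx h
    apply hpos x hx
    rw [hA, sub_mulVec, smul_mulVec, h, one_mulVec]
    module
  have ne_zero {Q : Mat4} (h : Q.trace ≠ 0) : Q ≠ 0 := by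
    rintro rfl
    simp at h
  obtain ⟨u, Q, hPQ, hu, hQQ, hQg, hQ⟩ :=
    exists_unit_split hs hPP hPg hPpos (ne_zero (by rw [hPtr]; norm_num))
  have hQtr : Q.trace = 1 := by
    have := congrArg trace hPQ
    rw [trace_add, trace_vecMulVec_mul hs, hu, hPtr] at this
    linarith
  obtain ⟨v, R, hQR, hv, hRR, hRg, hR⟩ := exists_unit_split hs hQQ hQg
    (fun x hx h ↦ hPpos x hx (hQ x h).1) (ne_zero (by rw [hQtr]; norm_num))
  have hRtr : R.trace = 0 := by
    have := congrArg trace hQR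
    rw [trace_add, trace_vecMulVec_mul hs, hv, hQtr] at this
    linarith
  have hR0 := eq_zero_of_mul_self_of_trace_eq_zero hRR hRtr
  rw [hR0, add_zero] at hQR
  have huv : u ⬝ᵥ g *ᵥ v = 0 := by
    refine (hQ v ?_).2
    rw [hQR, ← mulVec_mulVec, vecMulVec_mulVec, hv]
    simp
  have hW : wedge g u v * wedge g u v = -P := by
    rw [wedge_mul_self hs, huv, hu, hv, hPQ, hQR]
    module
  have hd : disc g u v = -1 := by
    rw [disc, huv, hu, hv]
    norm_num
  refine isSimple_of_exp_smul (u := u) (v := v) (r := Real.pi) ?_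
  rw [exp_of_cube_neg Real.pi_ne_zero]
  · simp only [Real.sin_pi, Real.cos_pi, Matrix.mul_smul, Matrix.smul_mul, hW, smul_smul]
    rw [hA]
    have : (1 - -1) / Real.pi ^ 2 * (Real.pi * Real.pi) = 2 := by
      field_simp
      norm_num
    rw [this]
    module
  · simp only [Matrix.mul_smul, Matrix.smul_mul, wedge_cube hs, hd]
    module

lemma isSimple_of_trace_eq_zero (hg : g.det ≠ 0) (hs : g.IsSymm) (he : IsTimelike g e)
    (hA : A ∈ properOrthochronous g) (ht : trk 2 A = 2 * A.trace - 2) (htr : A.trace = 0) :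
    IsSimple g A := by
  have hA' : A ∈ properLorentz g := connectedComponentIn_subset _ _ hA
  have hu : IsUnit A.det := by simp [hA'.2]
  have h1 := transpose_mul_eq_mul_inv hA'
  have h2 : A⁻¹ᵀ * g = g * A := by
    have := congrArg transpose h1
    simpa [hs.eq] using this.symm
  have hB : A - A⁻¹ = 0 := by
    refine eq_zero_of_skew_of_mul_self_eq_zero hs he ?_ ?_
    · rw [transpose_sub, sub_mul, h1, h2, mul_sub]
      abel
    · rw [sub_inv_mul_self hg hA' ht, htr, zero_smul]
  have hinv : A⁻¹ = A := (sub_eq_zero.1 hB).symm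
  rw [hinv] at h1
  have hAA : A * A = 1 := by
    have := nonsing_inv_mul A hu
    rwa [hinv] at this
  -- If `A x = -x`, then `e · x = -(A e · x)`, so the whole `-1` eigenspace is orthogonal to this
  -- vector.
  have hT : IsTimelike g (e + A *ᵥ e) := by
    refine he.of_neg hs ?_
    have ho := timelike_orientation he hA
    have hc := dotProduct_mulVec_comm hs (A *ᵥ e) e
    simp only [mulVec_add, dotProduct_add, add_dotProduct, dotProduct_mulVec_mulVec hA'.1, hc]
    linarith [he.neg]
  refine isSimple_of_mul_self_eq_one hs hAA h1 htr fun x hx h ↦ hT.pos_of_orthogonal x hx ?_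
  have h3 := dotProduct_mulVec_mulVec hA'.1 e x
  rw [h, mulVec_neg, dotProduct_neg] at h3
  rw [add_dotProduct]
  linarith

lemma properLorentz_neg (g : Mat4) : properLorentz (-g) = properLorentz g := by
  ext M
  simp [properLorentz]

lemma isSimple_neg_iff (g A : Mat4) : IsSimple (-g) A ↔ IsSimple g A := by
  have h (u v : Fin 4 → ℝ) : wedge (-g) u v = wedge g v u := by
    simp [wedge]
    abel
  simp only [IsSimple, h]
  exact exists_comm

end LorentzDecomp

theorem mainTheorem8 (g : LorentzDecomp.Mat4) (hg : LorentzDecomp.IsLorentzMetric g)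
    (A : LorentzDecomp.Mat4) (hA : A ∈ LorentzDecomp.properOrthochronous g) :
    LorentzDecomp.IsSimple g A ↔
      LorentzDecomp.trk 2 A = 2 * A.trace - 2 ∧ 0 ≤ A.trace := by
  refine ⟨LorentzDecomp.trk_of_isSimple hg.symm, fun ⟨ht, h0⟩ ↦ ?_⟩
  have hdet : g.det ≠ 0 := hg.det_neg.ne
  rcases h0.eq_or_lt with h | h
  · rcases LorentzDecomp.exists_isTimelike hg with ⟨e, he⟩ | ⟨e, he⟩
    · exact LorentzDecomp.isSimple_of_trace_eq_zero hdet hg.symm he hA ht h.symm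
    · rw [← LorentzDecomp.isSimple_neg_iff]
      refine LorentzDecomp.isSimple_of_trace_eq_zero ?_ hg.symm.neg he ?_ ht h.symm
      · simpa [Matrix.det_neg] using hdet
      · rwa [LorentzDecomp.properOrthochronous, LorentzDecomp.properLorentz_neg]
  · exact LorentzDecomp.isSimple_of_trace_pos hdet hg.symm
      (connectedComponentIn_subset _ _ hA) ht h
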